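/- For $n\ge 1$ let $S^{n-1}\subset\mathbb R^n$ be the unit sphere and $\sigma$ its $O(n)$-invariant probability measure. A cubature measure of strength $t$ on $S^{n-1}$ is a probability measure $\nu$ on $S^{n-1}$ supported on countably many points such that $\int p\,d\nu=\int p\,d\sigma$ for every real polynomial $p$ on $\mathbb R^n$ of degree at most $t$. For $0\le\theta<1$ and $\nu=\sum_i\nu_i\delta_{\xi_i}$ with distinct $\xi_i$ and $\nu_i>0$, put $\|\nu\|_\theta=\sum_i\nu_i^\theta\in[0,\infty]$, and let $\Theta(t,\theta,n)$ be the infimum of $\|\nu\|_\theta$ over all cubature measures $\nu$ of strength $t$ on $S^{n-1}$. (i) For every $n\ge1$ there is a constant $C_n>0$ such that $\Theta(t,\theta,n)\le (C_n t^{n-1})^{1-\theta}$ for all integers $t\ge1$ and all $\theta\in[0,1)$. Moreover, for every $n\ge2$ and $\theta\in[0,1)$, $$\limsup_{t\to\infty}\frac{\Theta(t,\theta,n)}{t^{(n-1)(1-\theta)}}\le\left(\frac{2^{n-1}}{(n-1)!}\right)^{1-\theta}.$$ (ii) For every integer $t\ge0$ there is a constant $C_t>0$ such that $\Theta(t,\theta,n)\le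 (C_t n^{2\lfloor t/2\rfloor})^{1-\theta}$ for all $n\ge1$ and all $\theta\in[0,1)$. Moreover, for every real $c>0$, the inequality holds for all $n\ge 1$ with $n>t/c$ and all $\theta\in[0,1)$ with $C_t=\frac{(1+2c)^t}{t!}$ if $t$ is even and with $C_t=2\,\frac{(1+2c)^{t-1}}{(t-1)!}$ if $t$ is odd. (iii) For every integer $t\ge2$ there is a constant $C'_t>0$ such that $\Theta(t,\theta,n)\le (C'_t n^{2\lfloor t/2\rfloor-1})^{1-\theta}$ for all $n\ge1$ and all $\theta\in[0,1)$. -/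

import Mathlib

open MeasureTheory Filter
open scoped ENNReal Nat

noncomputable section

namespace SphericalCubature

/-- The unit sphere `S^{n-1}` of the Euclidean space `ℝⁿ`. -/
abbrev Sphere (n : ℕ) : Type :=
  Metric.sphere (0 : EuclideanSpace ℝ (Fin n)) 1

/-- The rotation-invariant probability measure on `S^{n-1}`: surface measure, normalized. -/
def uniform (n : ℕ) : Measure (Sphere n) :=
  ((volume : Measure (EuclideanSpace ℝ (Fin n))).toSphere Set.univ)⁻¹ •
    (volume : Measure (EuclideanSpace ℝ (Fin n))).toSphere

/-- Discrete probability measures on `S^{n-1}`: those carried by a countable set. -/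
def IsDiscreteProb {n : ℕ} (ν : Measure (Sphere n)) : Prop :=
  IsProbabilityMeasure ν ∧ ∃ S : Set (Sphere n), S.Countable ∧ ν Sᶜ = 0

/-- Cubature measures of strength `t` on `S^{n-1}`: discrete probability measures that integrate
every polynomial on `ℝⁿ` of degree at most `t` as the uniform measure does. -/
def cubatureMeasures (t n : ℕ) : Set (Measure (Sphere n)) :=
  {ν | IsDiscreteProb ν ∧ ∀ p : MvPolynomial (Fin n) ℝ, p.totalDegree ≤ t →
    ∫ x : Sphere n, MvPolynomial.eval (fun i => (x : EuclideanSpace ℝ (Fin n)) i) p ∂ν =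
      ∫ x : Sphere n, MvPolynomial.eval (fun i => (x : EuclideanSpace ℝ (Fin n)) i) p ∂(uniform n)}

/-- `‖∑ νᵢ δ_{ξᵢ}‖_θ = ∑ νᵢ ^ θ`, the sum being over the atoms (the points of positive mass) only,
so that for `θ = 0` it is the number of atoms. -/
def thetaNorm {n : ℕ} (θ : ℝ) (ν : Measure (Sphere n)) : ℝ≥0∞ :=
  ∑' x : {x : Sphere n // ν {x} ≠ 0}, (ν {x.1}) ^ θ

/-- `Θ(t, θ, n)`: the infimum of `‖ν‖_θ` over cubature measures of strength `t` on `S^{n-1}`. -/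
def Theta (t : ℕ) (θ : ℝ) (n : ℕ) : ℝ≥0∞ :=
  ⨅ ν ∈ cubatureMeasures t n, thetaNorm θ ν

end SphericalCubature

end

noncomputable section

namespace SphericalCubature

/-! By Hölder, a probability measure with at most `N` atoms satisfies `∑ νᵢ ^ θ ≤ N ^ (1 - θ)`, so
every bound follows from a formula with few nodes and nonnegative weights, chosen independently of
`θ`.

For (i) and (ii), `tchakaloff` needs no more nodes than there are spanning functions. Since `∑ xᵢ² =
1` on the sphere, monomials of degrees `t` and `t - 1` span all polynomials of degree at most `t`.
For odd `t` and large `n` it is cheaper to be exact on forms of the even degree `t - 1` and to add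
antipodes, which kills odd monomials. The rest is counting monomials.

For (iii), put `s = t / 2`. By polar coordinates, Gaussian and spherical integrals are proportional
on forms of degree `2 * s`. The Gaussian is a product measure, and its marginal has an equal-weight
quadrature with `2 ^ r` nodes, `r` depending on `s` only (`exists_gauss_nodes`). Instead of the full
product grid, the rows of an orthogonal array of strength `2 * s` suffice
(`sum_arrayEntry_prod_pow`); they are then projected radially. The rows come from polynomials of
degree at most `2 * s - 1` over a field of size `O(n)`. The constant coefficient matters only
through its image in the alphabet of bounded size, which saves a factor `n` and leaves `O(n ^ (2 * s
- 1))` rows. -/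

/-- The monomial `x ^ α` as a function on the sphere. -/
def sphMono {n : ℕ} (α : Fin n → ℕ) (x : Sphere n) : ℝ :=
  ∏ i, (x : EuclideanSpace ℝ (Fin n)) i ^ α i

/-- There is a cubature formula of strength `t` on `S^{n-1}` with nonnegative weights and at most
`N` nodes. -/
def HasCubature (t n N : ℕ) : Prop :=
  ∃ (ι : Type) (_ : Fintype ι) (w : ι → ℝ) (ξ : ι → Sphere n),
    Fintype.card ι ≤ N ∧ (∀ i, 0 ≤ w i) ∧
    ∀ α : Fin n → ℕ, ∑ i, α i ≤ t → ∑ i, w i * sphMono α (ξ i) = ∫ x, sphMono α x ∂(uniform n)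

/-! ### From node counts to bounds on `Theta` -/

theorem continuous_sphMono {n : ℕ} (α : Fin n → ℕ) : Continuous (sphMono α) := by
  unfold sphMono
  fun_prop

theorem isProbabilityMeasure_uniform {n : ℕ} (hn : 1 ≤ n) : IsProbabilityMeasure (uniform n) := by
  have : Nonempty (Fin n) := ⟨⟨0, hn⟩⟩
  constructor
  rw [uniform, Measure.smul_apply, smul_eq_mul]
  refine ENNReal.inv_mul_cancel ?_ (measure_ne_top _ _)
  rw [Ne, Measure.measure_univ_eq_zero]
  exact Measure.toSphere_ne_zero _

theorem integrable_of_continuous {X : Type*} [TopologicalSpace X] [CompactSpace X]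
    [T2Space X] [MeasurableSpace X] [BorelSpace X] (μ : Measure X) [IsFiniteMeasure μ] {E : Type*}
    [NormedAddCommGroup E] [SecondCountableTopology E] {f : X → E}
    (hf : Continuous f) : Integrable f μ := by
  rw [← integrableOn_univ]
  exact hf.continuousOn.integrableOn_compact isCompact_univ

theorem sum_rpow_le {ι : Type*} (s : Finset ι) (a : ι → ℝ≥0∞) (ha : ∑ i ∈ s, a i ≤ 1) {θ : ℝ}
    (h0 : 0 ≤ θ) (h1 : θ < 1) : ∑ i ∈ s, a i ^ θ ≤ (s.card : ℝ≥0∞) ^ (1 - θ) := by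
  rcases h0.eq_or_lt with rfl | h0
  · simp
  -- Hölder against the constant function 1; the exponent `1 / θ` is why `θ = 0` is treated apart.
  have hpq : (1 / (1 - θ)).HolderConjugate (1 / θ) := by
    rw [Real.holderConjugate_iff]
    constructor
    · rw [lt_div_iff₀ (by linarith)]; linarith
    · simp
  have := ENNReal.inner_le_Lp_mul_Lq s (fun _ => 1) (fun i => a i ^ θ) hpq
  simp only [one_mul, ENNReal.one_rpow, one_div, inv_inv, Finset.sum_const, nsmul_eq_mul,
    mul_one, ENNReal.rpow_rpow_inv h0.ne'] at this
  refine this.trans ?_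
  calc _ ≤ (s.card : ℝ≥0∞) ^ (1 - θ) * 1 ^ θ := by gcongr
    _ = _ := by simp

theorem thetaNorm_le {n N : ℕ} (ν : Measure (Sphere n)) [IsProbabilityMeasure ν]
    (S : Finset (Sphere n)) (hS : S.card ≤ N) (hν : ∀ x, ν {x} ≠ 0 → x ∈ S) {θ : ℝ}
    (h0 : 0 ≤ θ) (h1 : θ < 1) : thetaNorm θ ν ≤ ENNReal.ofReal ((N : ℝ) ^ (1 - θ)) := by
  classical
  let T := S.filter fun x => ν {x} ≠ 0
  have hT : ∀ x, x ∈ T ↔ ν {x} ≠ 0 := fun x => by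
    simp only [T, Finset.mem_filter]; exact ⟨fun h => h.2, fun h => ⟨hν x h, h⟩⟩
  have hset : {x : Sphere n | ν {x} ≠ 0} = (T : Set (Sphere n)) := by
    ext x; simp [hT]
  have e : thetaNorm θ ν = ∑ x ∈ T, ν {x} ^ θ := by
    unfold thetaNorm
    change ∑' x : {x : Sphere n | ν {x} ≠ 0}, (ν {x.1}) ^ θ = _
    rw [hset]
    exact Finset.tsum_subtype T fun x => ν {x} ^ θ
  rw [e]
  refine (sum_rpow_le T _ ?_ h0 h1).trans ?_
  · rw [sum_measure_singleton]; exact prob_le_one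
  · rw [← ENNReal.ofReal_rpow_of_nonneg (by positivity) (by linarith), ENNReal.ofReal_natCast]
    have : T.card ≤ N := (Finset.card_filter_le _ _).trans hS
    gcongr

theorem integral_eval_eq_sum {n : ℕ} (μ : Measure (Sphere n)) [IsFiniteMeasure μ]
    (p : MvPolynomial (Fin n) ℝ) :
    ∫ x : Sphere n, MvPolynomial.eval (fun i => (x : EuclideanSpace ℝ (Fin n)) i) p ∂μ =
      ∑ d ∈ p.support, p.coeff d * ∫ x, sphMono d x ∂μ := by
  simp_rw [MvPolynomial.eval_eq']
  rw [integral_finsetSum]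
  · simp_rw [integral_const_mul]; rfl
  · intro d _
    exact (integrable_of_continuous μ (continuous_sphMono d)).const_mul _

theorem HasCubature.theta_le {t n N : ℕ} (h : HasCubature t n N) (hn : 1 ≤ n) {θ : ℝ}
    (h0 : 0 ≤ θ) (h1 : θ < 1) : Theta t θ n ≤ ENNReal.ofReal ((N : ℝ) ^ (1 - θ)) := by
  classical
  obtain ⟨ι, _, w, ξ, hcard, hw, hm⟩ := h
  have := isProbabilityMeasure_uniform hn
  -- Exactness on the monomial of degree 0.
  have hsum : ∑ i, w i = 1 := by simpa [sphMono] using hm 0 (by simp)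
  let ν : Measure (Sphere n) := ∑ i, ENNReal.ofReal (w i) • Measure.dirac (ξ i)
  have hprob : IsProbabilityMeasure ν := by
    constructor
    simp only [ν, Measure.coe_finsetSum, Finset.sum_apply, Measure.smul_apply, smul_eq_mul,
      measure_univ, mul_one]
    rw [← ENNReal.ofReal_sum_of_nonneg fun i _ => hw i, hsum, ENNReal.ofReal_one]
  have happ : ∀ s : Set (Sphere n), (∀ i, ξ i ∉ s) → ν s = 0 := by
    intro s hs
    simp only [ν, Measure.coe_finsetSum, Finset.sum_apply, Measure.smul_apply, smul_eq_mul]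
    refine Finset.sum_eq_zero fun i _ => ?_
    rw [Measure.dirac_apply, Set.indicator_of_notMem (hs i), mul_zero]
  have hintg : ∀ α, ∫ x, sphMono α x ∂ν = ∑ i, w i * sphMono α (ξ i) := by
    intro α
    rw [integral_finsetSum_measure]
    · refine Finset.sum_congr rfl fun i _ => ?_
      rw [integral_smul_measure, integral_dirac, ENNReal.toReal_ofReal (hw i), smul_eq_mul]
    · intro i _
      exact (integrable_of_continuous _ (continuous_sphMono α)).smul_measure ENNReal.ofReal_ne_top
  have hmem : ν ∈ cubatureMeasures t n := by
    refine ⟨⟨hprob, Set.range ξ, Set.countable_range ξ, happ _ fun i => by simp⟩, fun p hp => ?_⟩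
    rw [integral_eval_eq_sum, integral_eval_eq_sum]
    refine Finset.sum_congr rfl fun d hd => ?_
    rw [hintg, hm]
    refine le_trans ?_ hp
    have := MvPolynomial.le_totalDegree hd
    rwa [Finsupp.sum_fintype _ _ fun _ => rfl] at this
  refine (iInf₂_le ν hmem).trans ?_
  -- Nodes may coincide and weights may vanish; both only lower the number of atoms.
  refine thetaNorm_le ν (Finset.univ.image ξ) (Finset.card_image_le.trans hcard) ?_ h0 h1
  intro x hx
  by_contra hc
  refine hx (happ _ fun i hi => hc ?_)
  rw [← Set.mem_singleton_iff.1 hi]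
  exact Finset.mem_image_of_mem _ (Finset.mem_univ i)

theorem HasCubature.mono {t t' n N N' : ℕ} (h : HasCubature t n N) (ht : t' ≤ t) (hN : N ≤ N') :
    HasCubature t' n N' := by
  obtain ⟨ι, i, w, ξ, hcard, hw, hm⟩ := h
  exact ⟨ι, i, w, ξ, hcard.trans hN, hw, fun α hα => hm α (hα.trans ht)⟩

/-! ### Monomials restricted to the sphere -/

theorem sum_sq_eq_one {n : ℕ} (x : Sphere n) :
    ∑ i, (x : EuclideanSpace ℝ (Fin n)) i ^ 2 = 1 := by
  have h : ‖(x : EuclideanSpace ℝ (Fin n))‖ = 1 := by simp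
  have := EuclideanSpace.real_norm_sq_eq (x : EuclideanSpace ℝ (Fin n))
  rw [h] at this
  simpa using this.symm

theorem sphMono_add_single {n : ℕ} (α : Fin n → ℕ) (j : Fin n) (k : ℕ) (x : Sphere n) :
    sphMono (α + Pi.single j k) x = (x : EuclideanSpace ℝ (Fin n)) j ^ k * sphMono α x := by
  simp only [sphMono, Pi.add_apply, pow_add, Finset.prod_mul_distrib]
  rw [mul_comm]
  congr 1
  rw [Finset.prod_eq_single j]
  · simp
  · intro b _ hb; simp [hb]
  · simp

/-- On the sphere, a monomial is a combination of monomials of degree larger by an even number. -/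
theorem sphMono_mem_span {n k : ℕ} (j : ℕ) : ∀ α : Fin n → ℕ, ∑ i, α i + 2 * j = k →
    sphMono α ∈ Submodule.span ℝ
      (Set.range fun β : {β : Fin n → ℕ // ∑ i, β i = k} => sphMono β.1) := by
  induction j with
  | zero => intro α hα; exact Submodule.subset_span ⟨⟨α, by simpa using hα⟩, rfl⟩
  | succ j ih =>
    intro α hα
    -- Multiplication by `1 = ∑ xᵢ²` raises the degree by 2.
    have e : sphMono α = ∑ i, sphMono (α + Pi.single i 2) := by
      funext x
      rw [Finset.sum_apply]
      simp_rw [sphMono_add_single, ← Finset.sum_mul, sum_sq_eq_one, one_mul]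
    rw [e]
    refine Submodule.sum_mem _ fun i _ => ih _ ?_
    simp only [Pi.add_apply, Finset.sum_add_distrib, Finset.sum_pi_single', Finset.mem_univ,
      if_true]
    omega

theorem sum_mul_eq_integral_of_mem_span {X : Type*} [TopologicalSpace X] [CompactSpace X]
    [T2Space X] [MeasurableSpace X] [BorelSpace X] (μ : Measure X) [IsFiniteMeasure μ]
    {κ ι : Type*} [Fintype ι] (f : κ → X → ℝ) (hf : ∀ k, Continuous (f k)) (w : ι → ℝ) (ξ : ι → X)
    (h : ∀ k, ∑ i, w i * f k (ξ i) = ∫ x, f k x ∂μ) (g : X → ℝ)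
    (hg : g ∈ Submodule.span ℝ (Set.range f)) : ∑ i, w i * g (ξ i) = ∫ x, g x ∂μ := by
  suffices Continuous g ∧ ∑ i, w i * g (ξ i) = ∫ x, g x ∂μ from this.2
  induction hg using Submodule.span_induction with
  | mem g hg => obtain ⟨k, rfl⟩ := hg; exact ⟨hf k, h k⟩
  | zero => exact ⟨continuous_zero, by simp⟩
  | add a b _ _ ha hb =>
    refine ⟨ha.1.add hb.1, ?_⟩
    simp only [Pi.add_apply, mul_add, Finset.sum_add_distrib]
    rw [integral_add (integrable_of_continuous μ ha.1) (integrable_of_continuous μ hb.1), ha.2,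
      hb.2]
  | smul c a _ ha =>
    refine ⟨ha.1.const_smul c, ?_⟩
    simp only [Pi.smul_apply, smul_eq_mul]
    rw [integral_const_mul, ← ha.2, Finset.mul_sum]
    exact Finset.sum_congr rfl fun i _ => by ring

/-! ### Tchakaloff's theorem -/

/-- By Carathéodory, `dim E + 1` points suffice, so the hull is a continuous image of a compact set.
Shorter combinations are padded with zero weights at `x₀`. -/
theorem isCompact_convexHull_of_isCompact {E : Type*} [NormedAddCommGroup E] [NormedSpace ℝ E]
    [FiniteDimensional ℝ E] {s : Set E} (hs : IsCompact s) : IsCompact (convexHull ℝ s) := by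
  rcases s.eq_empty_or_nonempty with rfl | ⟨x₀, hx₀⟩
  · simp
  let d := Module.finrank ℝ E + 1
  have key : convexHull ℝ s = (fun p : (Fin d → ℝ) × (Fin d → E) => ∑ i, p.1 i • p.2 i) ''
      (stdSimplex ℝ (Fin d) ×ˢ Set.univ.pi fun _ => s) := by
    refine subset_antisymm (fun x hx => ?_) ?_
    · obtain ⟨ι, _, z, w, hz, haff, hw, hw1, hsum⟩ := eq_pos_convex_span_of_mem_convexHull hx
      have hcard : Fintype.card ι ≤ Fintype.card (Fin d) := by
        rw [Fintype.card_fin]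
        refine haff.card_le_finrank_succ.trans ?_
        exact Nat.succ_le_succ (Submodule.finrank_le _)
      obtain ⟨e⟩ := Function.Embedding.nonempty_of_card_le hcard
      have hout : ∀ i, i ∉ Set.range e → Function.extend e w 0 i = 0 := fun i hi => by
        rw [Function.extend_apply' _ _ _ fun ⟨a, ha⟩ => hi ⟨a, ha⟩]; rfl
      refine ⟨(Function.extend e w 0, Function.extend e z fun _ => x₀), ⟨⟨fun i => ?_, ?_⟩,
        fun i _ => ?_⟩, ?_⟩
      · by_cases hi : i ∈ Set.range e
        · obtain ⟨a, rfl⟩ := hi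
          simpa [e.injective.extend_apply] using (hw a).le
        · exact (hout i hi).ge
      · rw [← hw1]
        exact (Fintype.sum_of_injective e e.injective _ _ hout fun i => by
          rw [e.injective.extend_apply]).symm
      · by_cases hi : i ∈ Set.range e
        · obtain ⟨a, rfl⟩ := hi
          simpa [e.injective.extend_apply] using hz ⟨a, rfl⟩
        · simpa [Function.extend_apply' _ _ _ fun ⟨a, ha⟩ => hi ⟨a, ha⟩] using hx₀
      · rw [← hsum]
        refine (Fintype.sum_of_injective e e.injective _ _ (fun i hi => ?_) fun i => ?_).symm
        · simp only [hout i hi, zero_smul]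
        · simp only [e.injective.extend_apply]
    · rintro _ ⟨⟨w, z⟩, ⟨⟨hw, hw1⟩, hz⟩, rfl⟩
      exact (convex_convexHull ℝ s).sum_mem (fun i _ => hw i) hw1
        fun i _ => subset_convexHull ℝ s (hz i trivial)
  rw [key]
  refine ((isCompact_stdSimplex ℝ (Fin d)).prod (isCompact_univ_pi fun _ => hs)).image ?_
  fun_prop

/-- Tchakaloff's theorem: integrals of finitely many continuous functions whose span contains the
constants are given by a quadrature formula with at most as many nodes as there are functions. -/
theorem tchakaloff {X : Type*} [TopologicalSpace X] [CompactSpace X] [T2Space X]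
    [MeasurableSpace X] [BorelSpace X] (μ : Measure X) [IsProbabilityMeasure μ] {κ : Type}
    [Fintype κ] (f : κ → X → ℝ) (hf : ∀ k, Continuous (f k))
    (h1 : (fun _ => 1) ∈ Submodule.span ℝ (Set.range f)) :
    ∃ (ι : Type) (_ : Fintype ι) (w : ι → ℝ) (ξ : ι → X),
      Fintype.card ι ≤ Fintype.card κ ∧ (∀ i, 0 ≤ w i) ∧
      ∀ g ∈ Submodule.span ℝ (Set.range f), ∑ i, w i * g (ξ i) = ∫ x, g x ∂μ := by
  let Φ : X → κ → ℝ := fun x k => f k x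
  have hΦ : Continuous Φ := continuous_pi hf
  have hintg : Integrable Φ μ := integrable_of_continuous μ hΦ
  have hmem : ∫ x, Φ x ∂μ ∈ convexHull ℝ (Set.range Φ) := by
    refine (convex_convexHull ℝ _).integral_mem ?_ (Eventually.of_forall fun x =>
      subset_convexHull ℝ _ ⟨x, rfl⟩) hintg
    exact (isCompact_convexHull_of_isCompact (isCompact_range hΦ)).isClosed
  obtain ⟨ι, hι, z, w, hz, haff, hw, -, hsum⟩ := eq_pos_convex_span_of_mem_convexHull hmem
  choose ξ hξ using fun i => hz ⟨i, rfl⟩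
  rw [Submodule.mem_span_range_iff_exists_fun] at h1
  obtain ⟨c, hc⟩ := h1
  have hcz : ∀ i, ∑ k, c k * z i k = 1 := by
    intro i
    have := congrFun hc (ξ i)
    rw [← hξ i]
    simpa [Φ] using this
  -- A combination of the `f k` equal to 1 puts the `z i` on an affine hyperplane missing the
  -- origin. There affine independence is linear independence, so Carathéodory's extra node is not
  -- needed.
  have hlin : LinearIndependent ℝ z := by
    rw [Fintype.linearIndependent_iff]
    intro g hg i
    have hg0 : ∑ i, g i = 0 := by
      calc ∑ i, g i = ∑ i, g i * ∑ k, c k * z i k := by simp [hcz]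
        _ = ∑ k, c k * (∑ i, g i • z i) k := by
          simp_rw [Finset.mul_sum, Finset.sum_apply, Finset.mul_sum]
          rw [Finset.sum_comm]
          refine Finset.sum_congr rfl fun k _ => Finset.sum_congr rfl fun i _ => ?_
          simp only [Pi.smul_apply, smul_eq_mul]; ring
        _ = 0 := by rw [hg]; simp
    exact (affineIndependent_iff.1 haff) Finset.univ g hg0 hg i (Finset.mem_univ i)
  refine ⟨ι, hι, w, ξ, ?_, fun i => (hw i).le, ?_⟩
  · simpa using hlin.fintype_card_le_finrank
  · intro g hg
    refine sum_mul_eq_integral_of_mem_span μ f hf w ξ (fun k => ?_) g hg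
    have h := congrFun hsum k
    rw [eval_integral fun k => hintg.eval k] at h
    rw [← h]
    simp [← hξ, Φ]

/-! ### Antipodal symmetrization and node counts -/

theorem card_exponents (n k : ℕ) [Fintype {β : Fin n → ℕ // ∑ i, β i = k}] :
    Fintype.card {β : Fin n → ℕ // ∑ i, β i = k} = n.multichoose k := by
  rw [← Fintype.card_congr (Sym.equivNatSumOfFintype (Fin n) k), Sym.card_sym_eq_multichoose,
    Fintype.card_fin]

theorem sphMono_neg {n : ℕ} (α : Fin n → ℕ) (x : Sphere n) :
    sphMono α (-x) = (-1) ^ (∑ i, α i) * sphMono α x := by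
  simp only [sphMono]
  rw [← Finset.prod_pow_eq_pow_sum, ← Finset.prod_mul_distrib]
  refine Finset.prod_congr rfl fun i _ => ?_
  rw [← mul_pow]
  simp

/-- The surface measure of `s` is a multiple of the volume of the cone over `s`, and volume is
invariant under `x ↦ -x`. -/
theorem measurePreserving_neg_toSphere (n : ℕ) :
    MeasurePreserving (fun x : Sphere n => -x)
      (volume : Measure (EuclideanSpace ℝ (Fin n))).toSphere
      (volume : Measure (EuclideanSpace ℝ (Fin n))).toSphere := by
  have hm : Measurable fun x : Sphere n => -x := continuous_neg.measurable
  refine ⟨hm, ?_⟩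
  ext s hs
  rw [Measure.map_apply hm hs, Measure.toSphere_apply' _ (hm hs), Measure.toSphere_apply' _ hs]
  congr 1
  rw [← Measure.measure_neg volume]
  congr 1
  ext y
  simp only [Set.mem_neg, Set.mem_smul, Set.mem_image, Set.mem_preimage]
  constructor
  · rintro ⟨r, hr, _, ⟨x, hx, rfl⟩, h⟩
    exact ⟨r, hr, _, ⟨-x, hx, rfl⟩, by simpa [neg_eq_iff_eq_neg] using congrArg Neg.neg h⟩
  · rintro ⟨r, hr, _, ⟨x, hx, rfl⟩, rfl⟩
    exact ⟨r, hr, _, ⟨-x, by simpa using hx, rfl⟩, by simp⟩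

theorem integral_sphMono_of_odd {n : ℕ} (α : Fin n → ℕ) (hα : Odd (∑ i, α i)) :
    ∫ x, sphMono α x ∂(uniform n) = 0 := by
  have h := (measurePreserving_neg_toSphere n).integral_comp
    (Homeomorph.neg (Sphere n)).measurableEmbedding (sphMono α)
  simp_rw [sphMono_neg, hα.neg_one_pow, neg_one_mul, integral_neg] at h
  rw [uniform, integral_smul_measure]
  rw [show ∫ x, sphMono α x ∂(volume : Measure (EuclideanSpace ℝ (Fin n))).toSphere = 0 by
    linarith, smul_zero]

/-- The sphere is symmetric, so a formula that is exact on forms of degree `2 * s` gives one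
of strength `2 * s + 1` with twice as many nodes. -/
theorem hasCubature_of_exact_on_forms {n s N : ℕ} (hn : 1 ≤ n) {ι : Type} [Fintype ι] (w : ι → ℝ)
    (ξ : ι → Sphere n) (hcard : Fintype.card ι ≤ N) (hw : ∀ i, 0 ≤ w i)
    (h : ∀ α : Fin n → ℕ, ∑ i, α i = 2 * s →
      ∑ i, w i * sphMono α (ξ i) = ∫ x, sphMono α x ∂(uniform n)) :
    HasCubature (2 * s + 1) n (2 * N) := by
  have := isProbabilityMeasure_uniform hn
  refine ⟨ι ⊕ ι, inferInstance, fun i => (i.elim w w) / 2, Sum.elim ξ fun i => -ξ i, ?_, ?_, ?_⟩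
  · rw [Fintype.card_sum]; omega
  · rintro (i | i) <;> exact div_nonneg (hw i) zero_le_two
  · intro α hα
    simp only [Fintype.sum_sum_type, Sum.elim_inl, Sum.elim_inr, sphMono_neg]
    rw [← Finset.sum_add_distrib]
    rcases Nat.even_or_odd (∑ i, α i) with he | ho
    · obtain ⟨j, hj⟩ := he
      -- The degree is even and at most `2 * s + 1`, hence at most `2 * s`, so it can be raised to
      -- exactly `2 * s`.
      have hmem := sphMono_mem_span (k := 2 * s) (s - j) α (by omega)
      have hval := sum_mul_eq_integral_of_mem_span (uniform n)
        (fun β : {β : Fin n → ℕ // ∑ i, β i = 2 * s} => sphMono β.1)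
        (fun β => continuous_sphMono β.1) w ξ (fun β => h β.1 β.2) (sphMono α) hmem
      rw [← hval]
      refine Finset.sum_congr rfl fun i _ => ?_
      rw [Even.neg_one_pow ⟨j, hj⟩]
      ring
    · rw [integral_sphMono_of_odd α ho, ho.neg_one_pow]
      exact Finset.sum_eq_zero fun i _ => by ring

/-- Tchakaloff's theorem for forms of degree `2 * s`. -/
theorem exists_exact_on_forms {n s : ℕ} (hn : 1 ≤ n) :
    ∃ (ι : Type) (_ : Fintype ι) (w : ι → ℝ) (ξ : ι → Sphere n),
      Fintype.card ι ≤ n.multichoose (2 * s) ∧ (∀ i, 0 ≤ w i) ∧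
      ∀ α : Fin n → ℕ, ∑ i, α i = 2 * s →
        ∑ i, w i * sphMono α (ξ i) = ∫ x, sphMono α x ∂(uniform n) := by
  have := isProbabilityMeasure_uniform hn
  let _ : Fintype {β : Fin n → ℕ // ∑ i, β i = 2 * s} :=
    Fintype.ofEquiv _ (Sym.equivNatSumOfFintype (Fin n) (2 * s))
  obtain ⟨ι, hι, w, ξ, hcard, hw, h⟩ := tchakaloff (uniform n)
    (fun β : {β : Fin n → ℕ // ∑ i, β i = 2 * s} => sphMono β.1)
    (fun β => continuous_sphMono β.1) (by
      convert! sphMono_mem_span (n := n) (k := 2 * s) s 0 (by simp) using 1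
      funext x
      simp [sphMono])
  rw [card_exponents] at hcard
  exact ⟨ι, hι, w, ξ, hcard, hw, fun α hα => h _ (Submodule.subset_span ⟨⟨α, hα⟩, rfl⟩)⟩

theorem hasCubature_tchakaloff_symmetric {n : ℕ} (s : ℕ) (hn : 1 ≤ n) :
    HasCubature (2 * s + 1) n (2 * n.multichoose (2 * s)) := by
  obtain ⟨ι, hι, w, ξ, hcard, hw, h⟩ := exists_exact_on_forms (s := s) hn
  exact hasCubature_of_exact_on_forms hn w ξ hcard hw h

theorem hasCubature_zero {n : ℕ} (hn : 1 ≤ n) : HasCubature 0 n 1 := by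
  obtain ⟨ι, hι, w, ξ, hcard, hw, h⟩ := exists_exact_on_forms (s := 0) hn
  exact ⟨ι, hι, w, ξ, by simpa using hcard, hw, fun α hα => h α (by omega)⟩

/-- Parity decides whether a monomial of degree at most `t` is raised to degree `t` or to `t - 1`;
the two counts add up. -/
theorem hasCubature_tchakaloff {n t : ℕ} (hn : 1 ≤ n) (ht : 1 ≤ t) :
    HasCubature t n (n.multichoose t + n.multichoose (t - 1)) := by
  have := isProbabilityMeasure_uniform hn
  let _ (k : ℕ) : Fintype {β : Fin n → ℕ // ∑ i, β i = k} :=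
    Fintype.ofEquiv _ (Sym.equivNatSumOfFintype (Fin n) k)
  let f : {β : Fin n → ℕ // ∑ i, β i = t} ⊕ {β : Fin n → ℕ // ∑ i, β i = t - 1} →
      Sphere n → ℝ := Sum.elim (fun β => sphMono β.1) (fun β => sphMono β.1)
  have hspan : ∀ α : Fin n → ℕ, ∑ i, α i ≤ t → sphMono α ∈ Submodule.span ℝ (Set.range f) := by
    intro α hα
    rcases Nat.even_or_odd' (t - ∑ i, α i) with ⟨j, hj | hj⟩
    · refine Submodule.span_mono ?_ (sphMono_mem_span (k := t) j α (by omega))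
      rintro _ ⟨β, rfl⟩
      exact ⟨Sum.inl β, rfl⟩
    · refine Submodule.span_mono ?_ (sphMono_mem_span (k := t - 1) j α (by omega))
      rintro _ ⟨β, rfl⟩
      exact ⟨Sum.inr β, rfl⟩
  obtain ⟨ι, hι, w, ξ, hcard, hw, h⟩ := tchakaloff (uniform n) f
    (by rintro (β | β) <;> exact continuous_sphMono β.1) (by
      convert! hspan 0 (by simp) using 1
      funext x
      simp [sphMono])
  rw [Fintype.card_sum, card_exponents, card_exponents] at hcard
  exact ⟨ι, hι, w, ξ, hcard, hw, fun α hα => h _ (hspan α hα)⟩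

/-! ### Bounds (i) and (ii) -/

theorem multichoose_mul_factorial (n k : ℕ) : n.multichoose k * k ! = n.ascFactorial k := by
  rw [Nat.multichoose_eq, Nat.ascFactorial_eq_factorial_mul_choose', mul_comm]

theorem multichoose_mul_factorial_le {n : ℕ} (hn : 1 ≤ n) (k : ℕ) :
    n.multichoose k * k ! ≤ (n + 2 * k) ^ k := by
  rw [multichoose_mul_factorial]
  obtain ⟨m, rfl⟩ := Nat.exists_eq_add_of_le' hn
  refine (Nat.ascFactorial_le_pow_add m k).trans ?_
  exact Nat.pow_le_pow_left (by omega) k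

/-- The left side is exactly `(n + 2 * k + 1) * n.ascFactorial k`. Bounding the sum as a whole
avoids a spurious factor in the constant for even `t`. -/
theorem multichoose_add_mul_factorial_le {n : ℕ} (hn : 1 ≤ n) (k : ℕ) :
    (n.multichoose (k + 1) + n.multichoose k) * (k + 1)! ≤ (n + 2 * (k + 1)) ^ (k + 1) := by
  have h : n.ascFactorial k ≤ (n + 2 * (k + 1)) ^ k := by
    rw [← multichoose_mul_factorial]
    refine (multichoose_mul_factorial_le hn k).trans ?_
    gcongr
    omega
  calc (n.multichoose (k + 1) + n.multichoose k) * (k + 1)!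
      = n.multichoose (k + 1) * (k + 1)! + (k + 1) * (n.multichoose k * k !) := by
        rw [Nat.factorial_succ]; ring
    _ = (n + k + (k + 1)) * n.ascFactorial k := by
        rw [multichoose_mul_factorial, multichoose_mul_factorial, Nat.ascFactorial_succ]; ring
    _ ≤ (n + 2 * (k + 1)) * (n + 2 * (k + 1)) ^ k := Nat.mul_le_mul (by omega) h
    _ = _ := by ring

theorem multichoose_le_pow_div {n : ℕ} (hn : 1 ≤ n) {k t : ℕ} (hk : k ≤ t) :
    (n.multichoose k : ℝ) ≤ ((n : ℝ) + t) ^ (n - 1) / ((n - 1)! : ℝ) := by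
  -- Here `n` is fixed, so the binomial coefficient is read as `n - 1` out of `n + k - 1`, of degree
  -- `n - 1` in `k`.
  rw [Nat.multichoose_eq, ← Nat.choose_symm_of_eq_add (show n + k - 1 = (n - 1) + k by omega)]
  refine (Nat.choose_le_pow_div _ _).trans ?_
  gcongr
  exact_mod_cast (show n + k - 1 ≤ n + t by omega)

theorem HasCubature.theta_le_of_le {t n N : ℕ} (h : HasCubature t n N) (hn : 1 ≤ n) {θ B : ℝ}
    (h0 : 0 ≤ θ) (h1 : θ < 1) (hB : (N : ℝ) ≤ B) :
    Theta t θ n ≤ ENNReal.ofReal (B ^ (1 - θ)) := by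
  refine (h.theta_le hn h0 h1).trans (ENNReal.ofReal_le_ofReal ?_)
  exact Real.rpow_le_rpow (by positivity) hB (by linarith)

theorem theta_le_dimension {n t : ℕ} (hn : 1 ≤ n) (ht : 1 ≤ t) {θ : ℝ} (h0 : 0 ≤ θ) (h1 : θ < 1) :
    Theta t θ n ≤ ENNReal.ofReal
      ((2 * (((n : ℝ) + t) ^ (n - 1) / ((n - 1)! : ℝ))) ^ (1 - θ)) := by
  refine HasCubature.theta_le_of_le (hasCubature_tchakaloff hn ht) hn h0 h1 ?_
  push_cast
  linarith [multichoose_le_pow_div hn (le_refl t), multichoose_le_pow_div hn (Nat.sub_le t 1)]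

theorem theta_le_fixed_dimension {n : ℕ} (hn : 1 ≤ n) :
    ∃ C : ℝ, 0 < C ∧ ∀ t : ℕ, 1 ≤ t → ∀ θ : ℝ, 0 ≤ θ → θ < 1 →
      Theta t θ n ≤ ENNReal.ofReal ((C * (t : ℝ) ^ (n - 1)) ^ (1 - θ)) := by
  refine ⟨2 * (((n : ℝ) + 1) ^ (n - 1) / ((n - 1)! : ℝ)), by positivity, fun t ht θ h0 h1 => ?_⟩
  refine (theta_le_dimension hn ht h0 h1).trans (ENNReal.ofReal_le_ofReal ?_)
  have ht' : (1 : ℝ) ≤ t := by exact_mod_cast ht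
  refine Real.rpow_le_rpow (by positivity) ?_ (by linarith)
  rw [mul_assoc, div_mul_eq_mul_div, ← mul_pow]
  gcongr
  nlinarith [(Nat.cast_nonneg n : (0 : ℝ) ≤ n)]

theorem limsup_theta_le {n : ℕ} (hn : 2 ≤ n) {θ : ℝ} (h0 : 0 ≤ θ) (h1 : θ < 1) :
    limsup (fun t : ℕ => Theta t θ n /
        ENNReal.ofReal ((t : ℝ) ^ (((n : ℝ) - 1) * (1 - θ)))) atTop ≤
      ENNReal.ofReal (((2 : ℝ) ^ (n - 1) / ((n - 1)! : ℝ)) ^ (1 - θ)) := by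
  have hev : ∀ᶠ t : ℕ in atTop, Theta t θ n /
      ENNReal.ofReal ((t : ℝ) ^ (((n : ℝ) - 1) * (1 - θ))) ≤
      ENNReal.ofReal ((2 * (((n : ℝ) / t + 1) ^ (n - 1) / ((n - 1)! : ℝ))) ^ (1 - θ)) := by
    filter_upwards [eventually_ge_atTop 1] with t ht
    have ht' : (0 : ℝ) < t := by exact_mod_cast ht
    refine (ENNReal.div_le_div_right (theta_le_dimension (by omega) ht h0 h1) _).trans ?_
    rw [← ENNReal.ofReal_div_of_pos (by positivity)]
    refine ENNReal.ofReal_le_ofReal (le_of_eq ?_)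
    have hcast : (n : ℝ) - 1 = ((n - 1 : ℕ) : ℝ) := by
      rw [Nat.cast_sub (by omega), Nat.cast_one]
    rw [hcast, Real.rpow_mul ht'.le, Real.rpow_natCast, ← Real.div_rpow (by positivity)
      (by positivity)]
    congr 1
    rw [show (n : ℝ) / t + 1 = (n + t) / t by field_simp, div_pow]
    ring
  have hlim : Tendsto (fun t : ℕ => ENNReal.ofReal
      ((2 * (((n : ℝ) / t + 1) ^ (n - 1) / ((n - 1)! : ℝ))) ^ (1 - θ))) atTop
      (nhds (ENNReal.ofReal ((2 * (((0 : ℝ) + 1) ^ (n - 1) / ((n - 1)! : ℝ))) ^ (1 - θ)))) := by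
    refine ENNReal.tendsto_ofReal (Tendsto.rpow_const ?_ (Or.inr (by linarith)))
    exact ((((tendsto_const_div_atTop_nhds_zero_nat (n : ℝ)).add_const 1).pow _).div_const
      _).const_mul 2
  refine (limsup_le_limsup hev).trans ?_
  rw [hlim.limsup_eq]
  refine ENNReal.ofReal_le_ofReal (Real.rpow_le_rpow (by positivity) ?_ (by linarith))
  rw [zero_add, one_pow, mul_one_div]
  gcongr
  -- The count gives the constant `2 / (n - 1)!`, which is at most the claimed one because `n ≥ 2`.
  calc (2 : ℝ) = 2 ^ 1 := by norm_num
    _ ≤ 2 ^ (n - 1) := pow_le_pow_right₀ (by norm_num) (by omega)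

theorem theta_le_explicit {c : ℝ} (hc : 0 < c) {t n : ℕ} (hn : 1 ≤ n) (htn : (t : ℝ) / c < n)
    {θ : ℝ} (h0 : 0 ≤ θ) (h1 : θ < 1) :
    (Even t → Theta t θ n ≤
      ENNReal.ofReal (((1 + 2 * c) ^ t / (t ! : ℝ) * (n : ℝ) ^ (2 * (t / 2))) ^ (1 - θ))) ∧
    (Odd t → Theta t θ n ≤ ENNReal.ofReal
      ((2 * ((1 + 2 * c) ^ (t - 1) / ((t - 1)! : ℝ)) * (n : ℝ) ^ (2 * (t / 2))) ^ (1 - θ))) := by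
  rw [div_lt_iff₀ hc] at htn
  constructor
  · intro he
    rw [Nat.two_mul_div_two_of_even he]
    rcases t.eq_zero_or_pos with rfl | ht
    · exact HasCubature.theta_le_of_le (hasCubature_zero hn) hn h0 h1 (by simp)
    · refine HasCubature.theta_le_of_le (hasCubature_tchakaloff hn ht) hn h0 h1 ?_
      obtain ⟨k, rfl⟩ := Nat.exists_eq_add_of_le' ht
      rw [div_mul_eq_mul_div, ← mul_pow, le_div_iff₀ (by positivity)]
      have h : (((n.multichoose (k + 1) + n.multichoose k) * (k + 1)! : ℕ) : ℝ) ≤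
          (((n + 2 * (k + 1)) ^ (k + 1) : ℕ) : ℝ) :=
        Nat.cast_le.2 (multichoose_add_mul_factorial_le hn k)
      rw [Nat.cast_mul, Nat.cast_pow] at h
      refine h.trans ?_
      gcongr
      -- From `t < c * n` follows `n + 2 * t ≤ (1 + 2 * c) * n`.
      push_cast at htn ⊢
      linarith
  · rintro ⟨s, rfl⟩
    refine HasCubature.theta_le_of_le (hasCubature_tchakaloff_symmetric s hn) hn h0 h1 ?_
    rw [show (2 * s + 1) / 2 = s by omega, show 2 * s + 1 - 1 = 2 * s by omega, mul_assoc,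
      div_mul_eq_mul_div, ← mul_pow, Nat.cast_mul, Nat.cast_two]
    gcongr
    rw [le_div_iff₀ (by positivity)]
    have h : ((n.multichoose (2 * s) * (2 * s)! : ℕ) : ℝ) ≤
        (((n + 2 * (2 * s)) ^ (2 * s) : ℕ) : ℝ) :=
      Nat.cast_le.2 (multichoose_mul_factorial_le hn _)
    rw [Nat.cast_mul, Nat.cast_pow] at h
    refine h.trans ?_
    gcongr
    push_cast at htn ⊢
    linarith

theorem theta_le_fixed_strength (t : ℕ) :
    ∃ C : ℝ, 0 < C ∧ ∀ n : ℕ, 1 ≤ n → ∀ θ : ℝ, 0 ≤ θ → θ < 1 →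
      Theta t θ n ≤ ENNReal.ofReal ((C * (n : ℝ) ^ (2 * (t / 2))) ^ (1 - θ)) := by
  -- With `c = t + 1` the condition `t / c < n` holds for every `n ≥ 1`.
  have hlt : ∀ n : ℕ, 1 ≤ n → (t : ℝ) / (t + 1) < n := by
    intro n hn
    have : (1 : ℝ) ≤ n := by exact_mod_cast hn
    rw [div_lt_iff₀ (by positivity)]
    nlinarith [(Nat.cast_nonneg t : (0 : ℝ) ≤ t)]
  rcases Nat.even_or_odd t with he | ho
  · exact ⟨_, by positivity, fun n hn θ h0 h1 =>
      (theta_le_explicit (by positivity) hn (hlt n hn) h0 h1).1 he⟩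
  · exact ⟨_, by positivity, fun n hn θ h0 h1 =>
      (theta_le_explicit (by positivity) hn (hlt n hn) h0 h1).2 ho⟩

/-! ### Sets closed under midpoints -/

theorem convex_of_isClosed_of_midpoint {E : Type*} [NormedAddCommGroup E] [NormedSpace ℝ E]
    {S : Set E} (hS : IsClosed S) (h : ∀ x ∈ S, ∀ y ∈ S, (1 / 2 : ℝ) • (x + y) ∈ S) :
    Convex ℝ S := by
  intro x hx y hy a b ha hb hab
  let g : ℝ → E := fun t => (1 - t) • x + t • y
  have hg : Continuous g := by fun_prop
  -- Bisection: dyadic intervals shrink to `b` while their endpoints stay in `S`.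
  have key : ∀ k : ℕ, ∃ p q : ℝ, g p ∈ S ∧ g q ∈ S ∧ p ≤ b ∧ b ≤ q ∧ q - p = (1 / 2) ^ k := by
    intro k
    induction k with
    | zero => exact ⟨0, 1, by simpa [g], by simpa [g], hb, by linarith, by norm_num⟩
    | succ k ih =>
      obtain ⟨p, q, hp, hq, hpb, hbq, hpq⟩ := ih
      have hm : g ((p + q) / 2) ∈ S := by
        have e : g ((p + q) / 2) = (1 / 2 : ℝ) • (g p + g q) := by
          simp only [g]; module
        rw [e]
        exact h _ hp _ hq
      rcases le_total ((p + q) / 2) b with hb' | hb'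
      · exact ⟨_, q, hm, hq, hb', hbq, by rw [pow_succ]; linarith⟩
      · exact ⟨p, _, hp, hm, hpb, hb', by rw [pow_succ]; linarith⟩
  choose p q hp hq hpb hbq hpq using key
  have hlim : Tendsto p atTop (nhds b) := by
    have h0 : Tendsto (fun k : ℕ => b - (1 / 2 : ℝ) ^ k) atTop (nhds (b - 0)) :=
      (tendsto_pow_atTop_nhds_zero_of_lt_one (by norm_num) (by norm_num)).const_sub b
    rw [sub_zero] at h0
    exact tendsto_of_tendsto_of_tendsto_of_le_of_le h0 tendsto_const_nhds
      (fun k => by have := hpq k; have := hbq k; simp only; linarith) hpb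
  have : g b ∈ S := hS.mem_of_tendsto ((hg.tendsto b).comp hlim) (Eventually.of_forall hp)
  rwa [show a • x + b • y = g b by simp only [g]; rw [← hab]; simp]

/-- Write `m = τ c + (1 - τ) m'` with `τ = 2 ^ (-k)` so small that `m'` is still in the interior of
the closure. Replacing `m'` by a nearby `d ∈ D` moves the partner of `d` only slightly away from
`c`, so it stays in `D`, and `m` is a dyadic combination of two points of `D`. -/
theorem mem_of_mem_interior_closure_of_midpoint {E : Type*} [NormedAddCommGroup E]
    [NormedSpace ℝ E] {D : Set E} (h : ∀ x ∈ D, ∀ y ∈ D, (1 / 2 : ℝ) • (x + y) ∈ D) {c m : E}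
    (hc : D ∈ nhds c) (hm : m ∈ interior (closure D)) : m ∈ D := by
  have hcomb : ∀ k : ℕ, ∀ x ∈ D, ∀ y ∈ D,
      (1 / 2 : ℝ) ^ k • x + (1 - (1 / 2 : ℝ) ^ k) • y ∈ D := by
    intro k x hx y hy
    induction k with
    | zero => simpa
    | succ k ih =>
      convert! h _ ih _ hy using 1
      rw [pow_succ]
      module
  have hpow : Tendsto (fun k : ℕ => (1 / 2 : ℝ) ^ k) atTop (nhds 0) :=
    tendsto_pow_atTop_nhds_zero_of_lt_one (by norm_num) (by norm_num)
  have hlim : Tendsto (fun k : ℕ => (1 - (1 / 2 : ℝ) ^ k)⁻¹ • (m - (1 / 2 : ℝ) ^ k • c)) atTop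
      (nhds ((1 - (0 : ℝ))⁻¹ • (m - (0 : ℝ) • c))) :=
    ((hpow.const_sub 1).inv₀ (by norm_num)).smul ((hpow.smul_const c).const_sub m)
  simp only [sub_zero, inv_one, zero_smul, one_smul] at hlim
  obtain ⟨k, hk, hk1⟩ := ((hlim.eventually (isOpen_interior.mem_nhds hm)).and
    (eventually_ge_atTop 1)).exists
  set τ : ℝ := (1 / 2 : ℝ) ^ k with hτ
  have hτ0 : τ ≠ 0 := by positivity
  have hτ1 : 1 - τ ≠ 0 := by
    have : τ < 1 := pow_lt_one₀ (by norm_num) (by norm_num) (by omega)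
    linarith
  set m' := (1 - τ)⁻¹ • (m - τ • c) with hm'
  have hcont : Continuous fun d : E => τ⁻¹ • (m - (1 - τ) • d) := by fun_prop
  have hval : τ⁻¹ • (m - (1 - τ) • m') = c := by
    rw [hm', smul_inv_smul₀ hτ1, sub_sub_cancel, inv_smul_smul₀ hτ0]
  have hnear : {d : E | τ⁻¹ • (m - (1 - τ) • d) ∈ D} ∈ nhds m' :=
    hcont.continuousAt.preimage_mem_nhds (by rw [hval]; exact hc)
  obtain ⟨d, hd, hdD⟩ := mem_closure_iff_nhds.1 (interior_subset hk) _ hnear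
  have := hcomb k _ hd d hdD
  rwa [← hτ, smul_inv_smul₀ hτ0, sub_add_cancel] at this

/-! ### Equal-weight Gaussian quadrature -/

/-- The moment curve `x ↦ (x, x ^ 2, …, x ^ d)`. -/
def momentCurve (d : ℕ) (x : ℝ) : Fin d → ℝ := fun j => x ^ ((j : ℕ) + 1)

/-- Averages of `2 ^ r` points of the moment curve. -/
def dyadicMeans (d : ℕ) : Set (Fin d → ℝ) :=
  {y | ∃ (r : ℕ) (ι : Type) (_ : Fintype ι) (v : ι → ℝ), Fintype.card ι = 2 ^ r ∧
    y = ((2 : ℝ) ^ r)⁻¹ • ∑ a, momentCurve d (v a)}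

theorem momentCurve_mem_dyadicMeans (d : ℕ) (x : ℝ) : momentCurve d x ∈ dyadicMeans d :=
  ⟨0, Unit, inferInstance, fun _ => x, by simp, by simp⟩

/-- Each node is repeated `2 ^ s` times; this gives two means a common denominator. -/
theorem dyadicMeans_raise {d r : ℕ} {y : Fin d → ℝ} {ι : Type} [Fintype ι] (v : ι → ℝ)
    (hc : Fintype.card ι = 2 ^ r) (hy : y = ((2 : ℝ) ^ r)⁻¹ • ∑ a, momentCurve d (v a)) (s : ℕ) :
    ∃ (κ : Type) (_ : Fintype κ) (u : κ → ℝ), Fintype.card κ = 2 ^ (r + s) ∧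
      y = ((2 : ℝ) ^ (r + s))⁻¹ • ∑ a, momentCurve d (u a) := by
  refine ⟨ι × Fin (2 ^ s), inferInstance, fun a => v a.1, by simp [hc, pow_add], ?_⟩
  rw [hy, Fintype.sum_prod_type]
  simp only [Finset.sum_const, Finset.card_univ, Fintype.card_fin, ← Finset.smul_sum]
  rw [← Nat.cast_smul_eq_nsmul ℝ, smul_smul]
  congr 1
  push_cast
  rw [pow_add]
  field_simp

theorem midpoint_mem_dyadicMeans {d : ℕ} (x : Fin d → ℝ) (hx : x ∈ dyadicMeans d) (y : Fin d → ℝ)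
    (hy : y ∈ dyadicMeans d) : (1 / 2 : ℝ) • (x + y) ∈ dyadicMeans d := by
  obtain ⟨r, ι, _, v, hc, hx⟩ := hx
  obtain ⟨r', ι', _, v', hc', hy⟩ := hy
  obtain ⟨κ, _, u, hk, hx⟩ := dyadicMeans_raise v hc hx r'
  obtain ⟨κ', _, u', hk', hy⟩ := dyadicMeans_raise v' hc' hy r
  refine ⟨r + r' + 1, κ ⊕ κ', inferInstance, Sum.elim u u', ?_, ?_⟩
  · rw [Fintype.card_sum, hk, hk', add_comm r' r]; ring
  · rw [Fintype.sum_sum_type, hx, hy, add_comm r' r, ← smul_add, smul_smul]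
    congr 1
    rw [pow_succ]
    field_simp

/-- The averages of `2 ^ d` points of the moment curve have nonempty interior. -/
theorem exists_dyadicMeans_mem_nhds (d : ℕ) : ∃ c, dyadicMeans d ∈ nhds c := by
  let Ψ : (Fin d → ℝ) → (Fin d → ℝ) := fun x => ∑ i, momentCurve d (x i)
  let a : Fin d → ℝ := fun i => (i : ℕ)
  have ha : Function.Injective a := fun i j h => Fin.ext (by simpa [a] using h)
  let Ψ' : (Fin d → ℝ) →L[ℝ] (Fin d → ℝ) := ContinuousLinearMap.pi fun j =>
    ∑ i, (((j : ℕ) + 1 : ℝ) * a i ^ (j : ℕ)) • ContinuousLinearMap.proj i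
  have hΨ' : ∀ h j, Ψ' h j = ((j : ℕ) + 1 : ℝ) * ∑ i, h i * a i ^ (j : ℕ) := by
    intro h j
    simp only [Ψ', ContinuousLinearMap.pi_apply, sum_apply,
      smul_apply, ContinuousLinearMap.proj_apply, smul_eq_mul, Finset.mul_sum]
    exact Finset.sum_congr rfl fun i _ => by ring
  have hder : HasStrictFDerivAt Ψ Ψ' a := by
    rw [hasStrictFDerivAt_pi']
    intro j
    have e : (fun x => Ψ x j) = fun x => ∑ i, x i ^ ((j : ℕ) + 1) := by
      funext x; simp [Ψ, momentCurve, Finset.sum_apply]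
    rw [e]
    have : (ContinuousLinearMap.proj j).comp Ψ' =
        ∑ i, (((j : ℕ) + 1 : ℝ) * a i ^ (j : ℕ)) •
          (ContinuousLinearMap.proj i : (Fin d → ℝ) →L[ℝ] ℝ) := by
      ext h; rfl
    rw [this]
    refine HasStrictFDerivAt.fun_sum fun i _ => ?_
    have hp : HasStrictFDerivAt (fun x : Fin d → ℝ => x i) (ContinuousLinearMap.proj i) a :=
      (ContinuousLinearMap.proj i : (Fin d → ℝ) →L[ℝ] ℝ).hasStrictFDerivAt
    have hq := (hasStrictDerivAt_pow ((j : ℕ) + 1) (a i)).comp_hasStrictFDerivAt a hp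
    simp only [Nat.cast_add, Nat.cast_one, add_tsub_cancel_right] at hq
    exact hq
  -- At distinct points the derivative is a Vandermonde matrix with rows scaled by `j + 1`.
  have hinj : Function.Injective Ψ' := by
    rw [injective_iff_map_eq_zero]
    intro h hh
    refine Matrix.eq_zero_of_forall_pow_sum_mul_pow_eq_zero ha fun j => ?_
    have := congrFun hh j
    rw [hΨ', Pi.zero_apply, mul_eq_zero] at this
    exact this.resolve_left (by positivity)
  have hsurj : Ψ'.range = ⊤ :=
    LinearMap.range_eq_top.2 (LinearMap.surjective_of_injective (f := Ψ'.toLinearMap) hinj)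
  have hmap := hder.map_nhds_eq_of_surj hsurj
  have hrange : Set.range Ψ ∈ nhds (Ψ a) := by
    rw [← hmap]; exact Filter.range_mem_map
  refine ⟨((2 : ℝ) ^ d)⁻¹ • Ψ a, ?_⟩
  have h2 : ((2 : ℝ) ^ d)⁻¹ ≠ 0 := by positivity
  have := (smul_mem_nhds_smul_iff₀ h2).2 hrange
  refine mem_of_superset this ?_
  rintro _ ⟨_, ⟨x, rfl⟩, rfl⟩
  -- The `d` free nodes are padded to `2 ^ d` by nodes at 0, where the curve vanishes.
  refine ⟨d, Fin d ⊕ Fin (2 ^ d - d), inferInstance, Sum.elim x fun _ => 0, ?_, ?_⟩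
  · have : d < 2 ^ d := Nat.lt_two_pow_self
    simp only [Fintype.card_sum, Fintype.card_fin]
    omega
  · have h0 : momentCurve d 0 = 0 := by funext j; simp [momentCurve]
    simp [Fintype.sum_sum_type, h0, Ψ]

/-- The moments of the weight `exp (-x ^ 2)`. -/
def gaussMoment (k : ℕ) : ℝ := ∫ x : ℝ, x ^ k * Real.exp (-x ^ 2)

theorem integrable_pow_mul_exp (k : ℕ) : Integrable fun x : ℝ => x ^ k * Real.exp (-x ^ 2) := by
  have := integrable_rpow_mul_exp_neg_mul_sq one_pos (s := k)
    (by have := (Nat.cast_nonneg k : (0 : ℝ) ≤ k); linarith)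
  simpa using this

theorem gaussMoment_pos {k : ℕ} (hk : Even k) : 0 < gaussMoment k := by
  refine integral_pos_of_integrable_nonneg_nonzero (x := 1) (by fun_prop)
    (integrable_pow_mul_exp k) (fun x => mul_nonneg (hk.pow_nonneg x) (Real.exp_pos _).le) ?_
  simp

/-- Otherwise the Gaussian moment vector `m` can be separated from the interior of the closed convex
set `K`: some `f` has `f ≤ f m` on the curve. But `f m - f (momentCurve d x)` has Gaussian integral
0, so it vanishes identically. Then `f` equals `f m` on all means, against strict separation at `c`.
-/
theorem mem_dyadicMeans_gauss (d : ℕ) :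
    (fun j : Fin d => gaussMoment ((j : ℕ) + 1) / gaussMoment 0) ∈ dyadicMeans d := by
  obtain ⟨c, hc⟩ := exists_dyadicMeans_mem_nhds d
  refine mem_of_mem_interior_closure_of_midpoint midpoint_mem_dyadicMeans hc ?_
  set m := fun j : Fin d => gaussMoment ((j : ℕ) + 1) / gaussMoment 0 with hm
  set K := closure (dyadicMeans d) with hK
  have hconv : Convex ℝ K := by
    refine convex_of_isClosed_of_midpoint isClosed_closure fun x hx y hy => ?_
    exact map_mem_closure₂ (f := fun x y => (1 / 2 : ℝ) • (x + y)) (by fun_prop) hx hy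
      midpoint_mem_dyadicMeans
  have hcK : c ∈ interior K := mem_interior_iff_mem_nhds.2 (mem_of_superset hc subset_closure)
  by_contra hmK
  obtain ⟨f, hf⟩ := geometric_hahn_banach_open_point hconv.interior isOpen_interior hmK
  have hle : ∀ y ∈ K, f y ≤ f m := by
    -- Separation is known on the interior only; it passes to `K`, the closure of its interior, as a
    -- weak inequality.
    intro y hy
    have hy' : y ∈ closure (interior K) := by
      rw [hconv.closure_interior_eq_closure_of_nonempty_interior ⟨c, hcK⟩]
      exact subset_closure hy
    exact closure_minimal (fun z hz => (hf z hz).le)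
      (isClosed_le f.continuous continuous_const) hy'
  have hcurve : ∀ x, f (momentCurve d x) ≤ f m :=
    fun x => hle _ (subset_closure (momentCurve_mem_dyadicMeans d x))
  have hcoord : ∀ y : Fin d → ℝ, f y = ∑ j, y j * f (Pi.single j 1) := by
    intro y
    conv_lhs => rw [← Finset.univ_sum_single y, map_sum]
    refine Finset.sum_congr rfl fun j _ => ?_
    rw [← smul_eq_mul, ← map_smul, ← Pi.single_smul, smul_eq_mul, mul_one]
  have h0 := gaussMoment_pos (k := 0) (by simp)
  have hcontc : Continuous fun x => f (momentCurve d x) := by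
    refine f.continuous.comp (continuous_pi fun j => ?_)
    unfold momentCurve
    fun_prop
  have hex : ∀ x, (f m - f (momentCurve d x)) * Real.exp (-x ^ 2) =
      f m * (x ^ 0 * Real.exp (-x ^ 2)) - ∑ j : Fin d, f (Pi.single j 1) * (x ^ ((j : ℕ) + 1) * Real.exp (-x ^ 2)) := by
    intro x
    rw [sub_mul, hcoord (momentCurve d x), Finset.sum_mul]
    simp only [momentCurve, pow_zero, one_mul]
    congr 1
    exact Finset.sum_congr rfl fun j _ => by ring
  have hI1 : Integrable fun x : ℝ => f m * (x ^ 0 * Real.exp (-x ^ 2)) :=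
    (integrable_pow_mul_exp 0).const_mul _
  have hI2 : ∀ j : Fin d, Integrable fun x : ℝ =>
      f (Pi.single j 1) * (x ^ ((j : ℕ) + 1) * Real.exp (-x ^ 2)) :=
    fun j => (integrable_pow_mul_exp _).const_mul _
  have hintg : Integrable fun x => (f m - f (momentCurve d x)) * Real.exp (-x ^ 2) := by
    simp_rw [hex]
    exact hI1.sub (integrable_finsetSum _ fun j _ => hI2 j)
  have hzero : ∫ x, (f m - f (momentCurve d x)) * Real.exp (-x ^ 2) = 0 := by
    simp_rw [hex]
    rw [integral_sub hI1 (integrable_finsetSum _ fun j _ => hI2 j),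
      integral_finsetSum _ fun j _ => hI2 j]
    simp_rw [integral_const_mul]
    change f m * gaussMoment 0 - ∑ j : Fin d, f (Pi.single j 1) * gaussMoment ((j : ℕ) + 1) = 0
    rw [hcoord m, Finset.sum_mul, ← Finset.sum_sub_distrib]
    refine Finset.sum_eq_zero fun j _ => ?_
    simp only [hm]
    field_simp
    ring
  rw [integral_eq_zero_iff_of_nonneg (fun x => mul_nonneg (sub_nonneg.2 (hcurve x))
    (Real.exp_pos _).le) hintg] at hzero
  have hall := (Continuous.ae_eq_iff_eq volume
    ((continuous_const.sub hcontc).mul (by fun_prop)) continuous_zero).1 hzero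
  have heq : ∀ x, f (momentCurve d x) = f m := by
    intro x
    have hx : (f m - f (momentCurve d x)) * Real.exp (-x ^ 2) = 0 := congrFun hall x
    exact (sub_eq_zero.1 ((mul_eq_zero.1 hx).resolve_right (Real.exp_pos _).ne')).symm
  obtain ⟨r, ι, _, v, hcard, hv⟩ := mem_of_mem_nhds hc
  have hfc : f c = f m := by
    rw [hv, map_smul, map_sum]
    simp [heq, hcard]
  exact (hf c hcK).ne hfc

/-- Equal-weight Gaussian quadrature of degree `d` with `2 ^ r` nodes. -/
theorem exists_gauss_nodes (d : ℕ) : ∃ (r : ℕ) (v : (Fin r → ZMod 2) → ℝ),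
    ∀ k ≤ d, ∑ a, v a ^ k = 2 ^ r * (gaussMoment k / gaussMoment 0) := by
  obtain ⟨r, ι, _, v, hcard, hv⟩ := mem_dyadicMeans_gauss d
  have e : (Fin r → ZMod 2) ≃ ι := Fintype.equivOfCardEq (by simp [hcard, ZMod.card])
  refine ⟨r, v ∘ e, fun k hk => ?_⟩
  rw [Function.comp_def, e.sum_comp fun a => v a ^ k]
  rcases k with _ | k
  · simp [hcard, (gaussMoment_pos (k := 0) (by simp)).ne']
  · have := congrFun hv ⟨k, hk⟩
    simp only [Pi.smul_apply, Finset.sum_apply, momentCurve, smul_eq_mul] at this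
    rw [this]
    field_simp

/-! ### Orthogonal arrays over finite fields -/

/-- All fibres are cosets of the kernel and have the same size, so `f` carries the uniform
distribution to the uniform one. -/
theorem card_mul_sum_comp_of_surjective {G H : Type*} [AddGroup G] [Fintype G] [AddGroup H]
    [Fintype H] (f : G →+ H) (hf : Function.Surjective f) (g : H → ℝ) :
    (Fintype.card H : ℝ) * ∑ x, g (f x) = Fintype.card G * ∑ y, g y := by
  classical
  have hfib : ∀ y, (Finset.univ.filter fun x => f x = y).card =
      (Finset.univ.filter fun x => f x = 0).card :=
    fun y => AddMonoidHom.card_fiber_eq_of_mem_range f (hf y) (hf 0)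
  have hcard : Fintype.card G =
      Fintype.card H * (Finset.univ.filter fun x => f x = 0).card := by
    rw [← Finset.card_univ, Finset.card_eq_sum_card_fiberwise (f := f) (t := Finset.univ)
      fun _ _ => by simp]
    simp [hfib]
  have hsum : ∑ x, g (f x) = (Finset.univ.filter fun x => f x = 0).card * ∑ y, g y := by
    rw [← Finset.sum_fiberwise (s := Finset.univ) (g := f), Finset.mul_sum]
    refine Finset.sum_congr rfl fun y _ => ?_
    rw [← hfib y, ← nsmul_eq_mul, ← Finset.sum_const]
    refine Finset.sum_congr rfl fun x hx => ?_
    rw [(Finset.mem_filter.1 hx).2]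
  rw [hsum, hcard]
  push_cast
  ring

/-- The entries of the array with rows indexed by `A × (Fin K → F)`: the row `(c, a)` is
`i ↦ c + ψ (∑ j, a j * ζ i ^ (j + 1))`. -/
def arrayEntry {F A ι : Type*} [Field F] [AddCommGroup A] (ψ : F →+ A) (K : ℕ) (ζ : ι → F) :
    A × (Fin K → F) →+ (ι → A) where
  toFun p i := p.1 + ψ (∑ j, p.2 j * ζ i ^ ((j : ℕ) + 1))
  map_zero' := by funext i; simp
  map_add' p q := by
    funext i
    simp only [Prod.fst_add, Prod.snd_add, Pi.add_apply, add_mul, Finset.sum_add_distrib, map_add]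
    abel

/-- Any `K + 1` columns of the array are independent. -/
theorem arrayEntry_surjective {F A ι : Type*} [Field F] [AddCommGroup A] [Fintype ι]
    {ψ : F →+ A} (hψ : Function.Surjective ψ) {K : ℕ} {ζ : ι → F} (hζ : Function.Injective ζ)
    (hι : Fintype.card ι ≤ K + 1) : Function.Surjective (arrayEntry ψ K ζ) := by
  classical
  intro u
  choose w hw using fun i => hψ (u i)
  let P := Lagrange.interpolate Finset.univ ζ w
  have hdeg : P.degree < ((K + 1 : ℕ) : WithBot ℕ) :=
    (Lagrange.degree_interpolate_lt w hζ.injOn).trans_le (by exact_mod_cast hι)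
  have hnat : P.natDegree < K + 1 := by
    rw [Nat.lt_succ_iff]
    exact Polynomial.natDegree_le_of_degree_le (Order.lt_succ_iff.1 (by exact_mod_cast hdeg))
  -- The interpolating polynomial has degree at most `K`; of its constant coefficient only the image
  -- under `ψ` is kept.
  refine ⟨(ψ (P.coeff 0), fun j => P.coeff ((j : ℕ) + 1)), ?_⟩
  funext i
  have heval : P.eval (ζ i) = w i :=
    Lagrange.eval_interpolate_at_node w hζ.injOn (Finset.mem_univ i)
  rw [Polynomial.eval_eq_sum_range' hnat, Finset.sum_range_succ', pow_zero, mul_one] at heval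
  change ψ (P.coeff 0) + ψ (∑ j : Fin K, P.coeff ((j : ℕ) + 1) * ζ i ^ ((j : ℕ) + 1)) = u i
  rw [Fin.sum_univ_eq_sum_range (fun j => P.coeff (j + 1) * ζ i ^ (j + 1)) K, ← map_add, add_comm,
    heval, hw]

/-- Monomials of degree at most `K + 1` average over the rows of the array as if the columns were
independent and uniformly distributed. -/
theorem sum_arrayEntry_prod_pow {F A ι : Type*} [Field F] [Fintype F] [AddCommGroup A] [Fintype A]
    [Fintype ι] {ψ : F →+ A} (hψ : Function.Surjective ψ) {K : ℕ} {ζ : ι → F}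
    (hζ : Function.Injective ζ) (v : A → ℝ) (α : ι → ℕ) (hα : ∑ i, α i ≤ K + 1) :
    ∑ p : A × (Fin K → F), ∏ i, v (arrayEntry ψ K ζ p i) ^ α i =
      Fintype.card (A × (Fin K → F)) * ∏ i, ((∑ a, v a ^ α i) / Fintype.card A) := by
  classical
  -- Each column that occurs adds at least 1 to the degree, so at most `K + 1` occur and they are
  -- independent.
  let S := {i // α i ≠ 0}
  have hprod : ∀ f : ι → ℝ, (∀ i, α i = 0 → f i = 1) → ∏ i, f i = ∏ i : S, f i := fun f hf =>
    (Fintype.prod_of_injective (Subtype.val : S → ι) Subtype.val_injective _ _ (fun i hi => by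
      refine hf i ?_
      by_contra h
      exact hi ⟨⟨i, h⟩, rfl⟩) fun _ => rfl).symm
  have hS : Fintype.card S ≤ K + 1 := by
    refine le_trans ?_ hα
    rw [Fintype.card_subtype, Finset.card_eq_sum_ones, Finset.sum_filter]
    refine Finset.sum_le_sum fun i _ => ?_
    split_ifs <;> omega
  have hA : (Fintype.card A : ℝ) ≠ 0 := by
    exact_mod_cast Fintype.card_ne_zero
  have key := card_mul_sum_comp_of_surjective (arrayEntry ψ K fun i : S => ζ i)
    (arrayEntry_surjective hψ (hζ.comp Subtype.val_injective) hS)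
    fun u => ∏ i : S, v (u i) ^ α i
  have hsplit : ∑ u : S → A, ∏ i : S, v (u i) ^ α i = ∏ i : S, ∑ a, v a ^ α i := by
    rw [Finset.prod_univ_sum, Fintype.piFinset_univ]
  rw [hsplit, Fintype.card_fun, Nat.cast_pow] at key
  rw [hprod _ fun i hi => by simp [hi, hA], Finset.prod_div_distrib, Finset.prod_const,
    Finset.card_univ, mul_div_assoc', eq_div_iff (pow_ne_zero _ hA), ← key, mul_comm]
  congr 1
  exact Finset.sum_congr rfl fun p _ => hprod _ fun i hi => by simp [hi]

/-- A field with at least `n` and at most `2 ^ (r + 1) * n` elements that maps additively onto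
`(ℤ / 2) ^ r`. -/
theorem exists_field_additive_surjection (r : ℕ) {n : ℕ} (hn : 1 ≤ n) :
    ∃ (F : Type) (_ : Field F) (_ : Fintype F) (ψ : F →+ (Fin r → ZMod 2)),
      Function.Surjective ψ ∧ n ≤ Fintype.card F ∧ Fintype.card F ≤ 2 ^ (r + 1) * n := by
  obtain ⟨l, hl, hl'⟩ := exists_nat_pow_near (y := 2) hn (by norm_num)
  -- From `2 ^ l ≤ n < 2 ^ (l + 1)`: the summand `l + 1` makes the field large enough, and `r`
  -- leaves room for the surjection.
  let m := r + (l + 1)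
  have hm : m ≠ 0 := by omega
  let _ : Fintype (GaloisField 2 m) := Fintype.ofFinite _
  have hcard : Fintype.card (GaloisField 2 m) = 2 ^ m := by
    rw [← Nat.card_eq_fintype_card, GaloisField.card 2 m hm]
  let e : GaloisField 2 m ≃ₗ[ZMod 2] (Fin m → ZMod 2) :=
    (Module.finBasisOfFinrankEq _ _ (GaloisField.finrank 2 hm)).equivFun
  let ψ : GaloisField 2 m →ₗ[ZMod 2] (Fin r → ZMod 2) :=
    (LinearMap.funLeft (ZMod 2) (ZMod 2) (Fin.castLE (show r ≤ m by omega))).comp e.toLinearMap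
  have hψ : Function.Surjective ψ := by
    have h := LinearMap.funLeft_surjective_of_injective (ZMod 2) (ZMod 2) _
      (Fin.castLE_injective (show r ≤ m by omega))
    exact Function.Surjective.comp (f := e) h e.surjective
  refine ⟨GaloisField 2 m, inferInstance, inferInstance, ψ.toAddMonoidHom, hψ, ?_, ?_⟩
  · rw [hcard]
    exact hl'.le.trans (Nat.pow_le_pow_right (by norm_num) (by omega))
  · rw [hcard, show m = r + 1 + l by omega, pow_add]
    exact Nat.mul_le_mul_left _ hl

/-! ### From Gaussian to spherical integrals -/

theorem prod_pow_eq_norm_pow_mul_sphMono {n : ℕ} {x : EuclideanSpace ℝ (Fin n)} (hx : x ≠ 0)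
    (ω : Sphere n) (hω : (ω : EuclideanSpace ℝ (Fin n)) = ‖x‖⁻¹ • x) (α : Fin n → ℕ) :
    ∏ i, x i ^ α i = ‖x‖ ^ (∑ i, α i) * sphMono α ω := by
  have h : ‖x‖ ≠ 0 := norm_ne_zero_iff.2 hx
  rw [sphMono, hω, ← Finset.prod_pow_eq_pow_sum, ← Finset.prod_mul_distrib]
  refine Finset.prod_congr rfl fun i _ => ?_
  rw [← mul_pow, PiLp.smul_apply, smul_eq_mul, mul_inv_cancel_left₀ h]

theorem exists_sphere_point {n : ℕ} (hn : 1 ≤ n) (x : EuclideanSpace ℝ (Fin n)) :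
    ∃ ω : Sphere n, ∀ α : Fin n → ℕ, 1 ≤ ∑ i, α i →
      ∏ i, x i ^ α i = ‖x‖ ^ (∑ i, α i) * sphMono α ω := by
  by_cases hx : x = 0
  -- The origin has no radial projection, but in positive degree both sides vanish at any choice of
  -- `ω`.
  · have : Nonempty (Fin n) := ⟨⟨0, hn⟩⟩
    obtain ⟨ω⟩ : Nonempty (Sphere n) := (NormedSpace.sphere_nonempty.2 zero_le_one).to_subtype
    refine ⟨ω, fun α hα => ?_⟩
    obtain ⟨i, -, hi⟩ := Finset.exists_ne_zero_of_sum_ne_zero (show ∑ i, α i ≠ 0 by omega)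
    rw [hx, Finset.prod_eq_zero (Finset.mem_univ i) (by simp [hi]), norm_zero,
      zero_pow (by omega), zero_mul]
  · have h : ‖x‖ ≠ 0 := norm_ne_zero_iff.2 hx
    exact ⟨⟨‖x‖⁻¹ • x, by simp [norm_smul, h]⟩,
      fun α _ => prod_pow_eq_norm_pow_mul_sphMono hx _ rfl α⟩

/-- Gaussian integrals of monomials in polar coordinates. -/
theorem prod_gaussMoment_eq {n : ℕ} (hn : 1 ≤ n) (α : Fin n → ℕ) :
    ∏ i, gaussMoment (α i) =
      (∫ ω, sphMono α ω ∂(volume : Measure (EuclideanSpace ℝ (Fin n))).toSphere) *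
      ∫ r : Set.Ioi (0 : ℝ), (r : ℝ) ^ (∑ i, α i) * Real.exp (-(r : ℝ) ^ 2)
        ∂(Measure.volumeIoiPow (n - 1)) := by
  have : Nonempty (Fin n) := ⟨⟨0, hn⟩⟩
  let g : EuclideanSpace ℝ (Fin n) → ℝ := fun x => ∏ i, (x i ^ α i * Real.exp (-x i ^ 2))
  have hg : ∏ i, gaussMoment (α i) = ∫ x, g x := by
    rw [← (PiLp.volume_preserving_toLp (Fin n)).integral_comp
      (MeasurableEquiv.toLp 2 (Fin n → ℝ)).measurableEmbedding]
    exact (integral_fintype_prod_volume_eq_prod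
      (fun (i : Fin n) (y : ℝ) => y ^ α i * Real.exp (-y ^ 2))).symm
  have hpolar := (Measure.measurePreserving_homeomorphUnitSphereProd
    (volume : Measure (EuclideanSpace ℝ (Fin n)))).integral_comp
    (Homeomorph.measurableEmbedding _) fun q =>
      sphMono α q.1 * ((q.2 : ℝ) ^ (∑ i, α i) * Real.exp (-(q.2 : ℝ) ^ 2))
  rw [integral_prod_mul (sphMono α) fun r : Set.Ioi (0 : ℝ) =>
    (r : ℝ) ^ (∑ i, α i) * Real.exp (-(r : ℝ) ^ 2), finrank_euclideanSpace_fin] at hpolar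
  have hsub : ∫ x, g x = ∫ x : ({0}ᶜ : Set (EuclideanSpace ℝ (Fin n))), g x
      ∂(Measure.comap Subtype.val volume) := by
    rw [integral_subtype_comap (measurableSet_singleton _).compl g, restrict_compl_singleton]
  rw [hg, ← hpolar, hsub]
  congr 1
  funext x
  have hx : (x : EuclideanSpace ℝ (Fin n)) ≠ 0 := x.2
  simp only [g, Finset.prod_mul_distrib]
  rw [prod_pow_eq_norm_pow_mul_sphMono hx
      (homeomorphUnitSphereProd (EuclideanSpace ℝ (Fin n)) x).1 (by simp) α,
    ← Real.exp_sum, Finset.sum_neg_distrib, ← EuclideanSpace.real_norm_sq_eq]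
  simp only [homeomorphUnitSphereProd_apply_snd_coe]
  ring

/-- The radial factor in polar coordinates depends on `α` only through its total degree. -/
theorem exists_prod_gaussMoment_eq_mul_integral {n : ℕ} (hn : 1 ≤ n) {k : ℕ} (hk : Even k) :
    ∃ c : ℝ, 0 < c ∧ ∀ α : Fin n → ℕ, ∑ i, α i = k →
      ∏ i, gaussMoment (α i) = c * ∫ ω, sphMono α ω ∂(uniform n) := by
  have : Nonempty (Fin n) := ⟨⟨0, hn⟩⟩
  set σ := (volume : Measure (EuclideanSpace ℝ (Fin n))).toSphere with hσ
  have hV : (σ Set.univ).toReal ≠ 0 := by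
    rw [ENNReal.toReal_ne_zero]
    exact ⟨by rw [Ne, Measure.measure_univ_eq_zero]; exact Measure.toSphere_ne_zero _,
      measure_ne_top _ _⟩
  let c : ℝ := (σ Set.univ).toReal * ∫ r : Set.Ioi (0 : ℝ), (r : ℝ) ^ k *
    Real.exp (-(r : ℝ) ^ 2) ∂(Measure.volumeIoiPow (n - 1))
  have hc : ∀ α : Fin n → ℕ, ∑ i, α i = k →
      ∏ i, gaussMoment (α i) = c * ∫ ω, sphMono α ω ∂(uniform n) := by
    intro α hα
    rw [prod_gaussMoment_eq hn, hα, uniform, integral_smul_measure, ENNReal.toReal_inv, ← hσ,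
      smul_eq_mul]
    simp only [c]
    field_simp
  refine ⟨c, ?_, hc⟩
  -- The sign of `c` is read off from the `k`-th power of one coordinate, nonnegative because `k` is
  -- even.
  let α : Fin n → ℕ := Pi.single ⟨0, hn⟩ k
  have heven : ∀ i, Even (α i) := fun i => by
    by_cases hi : i = ⟨0, hn⟩
    · subst hi; simpa [α] using hk
    · simp [α, hi]
  have hpos : 0 < ∏ i, gaussMoment (α i) :=
    Finset.prod_pos fun i _ => gaussMoment_pos (heven i)
  rw [hc α (by simp [α])] at hpos
  refine pos_of_mul_pos_left hpos (integral_nonneg fun ω => ?_)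
  exact Finset.prod_nonneg fun i _ => (heven i).pow_nonneg _

/-! ### Bound (iii) -/

/-- Cubature formulas from orthogonal arrays whose entries are nodes of a Gaussian quadrature
formula, projected radially to the sphere. -/
theorem exists_hasCubature_array {s : ℕ} (hs : 1 ≤ s) :
    ∃ C : ℕ, 0 < C ∧ ∀ n : ℕ, 1 ≤ n → HasCubature (2 * s + 1) n (C * n ^ (2 * s - 1)) := by
  obtain ⟨r, v, hv⟩ := exists_gauss_nodes (2 * s)
  -- The factors are 2 for antipodes, `2 ^ r` for the alphabet, and the `n`-free part of the bound
  -- `(2 ^ (r + 1) * n) ^ (2 * s - 1)` on the number of coefficient vectors.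
  refine ⟨2 * (2 ^ r * (2 ^ (r + 1)) ^ (2 * s - 1)), by positivity, fun n hn => ?_⟩
  obtain ⟨F, _, _, ψ, hψ, hF, hF'⟩ := exists_field_additive_surjection r hn
  obtain ⟨ζ⟩ := Function.Embedding.nonempty_of_card_le (α := Fin n) (β := F) (by simpa using hF)
  obtain ⟨c, hc0, hc⟩ := exists_prod_gaussMoment_eq_mul_integral hn (even_two_mul s)
  have hG := gaussMoment_pos (k := 0) (by simp)
  set K := 2 * s - 1 with hK
  let x : (Fin r → ZMod 2) × (Fin K → F) → EuclideanSpace ℝ (Fin n) :=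
    fun p => WithLp.toLp 2 fun i => v (arrayEntry ψ K ζ p i)
  choose ξ hξ using fun p => exists_sphere_point hn (x p)
  let Q : ℝ := Fintype.card ((Fin r → ZMod 2) × (Fin K → F)) * (c / gaussMoment 0 ^ n)
  have hQ : 0 < Q := by
    have : 0 < Fintype.card ((Fin r → ZMod 2) × (Fin K → F)) := Fintype.card_pos
    have : (0 : ℝ) < Fintype.card ((Fin r → ZMod 2) × (Fin K → F)) := by exact_mod_cast this
    positivity
  have hcardA : Fintype.card (Fin r → ZMod 2) = 2 ^ r := by simp [ZMod.card]
  have hsum : ∀ α : Fin n → ℕ, ∑ i, α i = 2 * s →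
      ∑ p, ∏ i, x p i ^ α i = Q * ∫ ω, sphMono α ω ∂(uniform n) := by
    intro α hα
    have h := sum_arrayEntry_prod_pow hψ (K := K) ζ.injective v α (by omega)
    have hfac : ∀ i, (∑ a, v a ^ α i) / Fintype.card (Fin r → ZMod 2) =
        gaussMoment (α i) / gaussMoment 0 := by
      intro i
      have hi : α i ≤ 2 * s := hα ▸ Finset.single_le_sum (fun _ _ => Nat.zero_le _)
        (Finset.mem_univ i)
      rw [hv _ hi, hcardA]
      push_cast
      field_simp
    simp_rw [hfac] at h
    rw [Finset.prod_div_distrib, hc α hα, Finset.prod_const, Finset.card_univ,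
      Fintype.card_fin] at h
    refine h.trans ?_
    simp only [Q]
    ring
  rw [show 2 * (2 ^ r * (2 ^ (r + 1)) ^ K) * n ^ K = 2 * (2 ^ r * (2 ^ (r + 1) * n) ^ K) by
    rw [mul_pow]; ring]
  -- By homogeneity, projecting a row to the sphere costs the factor `‖x p‖ ^ (2 * s)`, which the
  -- weight absorbs.
  refine hasCubature_of_exact_on_forms hn (fun p => ‖x p‖ ^ (2 * s) / Q) ξ ?_
    (fun p => by positivity) fun α hα => ?_
  · rw [Fintype.card_prod, hcardA, Fintype.card_fun, Fintype.card_fin]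
    gcongr
  · have hterm : ∀ p, ‖x p‖ ^ (2 * s) / Q * sphMono α (ξ p) = (∏ i, x p i ^ α i) / Q := by
      intro p
      rw [hξ p α (by omega), hα]
      ring
    simp_rw [hterm]
    rw [← Finset.sum_div, hsum α hα, mul_div_cancel_left₀ _ hQ.ne']

theorem theta_le_fixed_strength_array {t : ℕ} (ht : 2 ≤ t) :
    ∃ C : ℝ, 0 < C ∧ ∀ n : ℕ, 1 ≤ n → ∀ θ : ℝ, 0 ≤ θ → θ < 1 →
      Theta t θ n ≤ ENNReal.ofReal ((C * (n : ℝ) ^ (2 * (t / 2) - 1)) ^ (1 - θ)) := by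
  obtain ⟨C, hC, h⟩ := exists_hasCubature_array (s := t / 2) (by omega)
  refine ⟨C, by exact_mod_cast hC, fun n hn θ h0 h1 => ?_⟩
  exact ((h n hn).mono (t' := t) (by omega) le_rfl).theta_le_of_le hn h0 h1 (by push_cast; rfl)

end SphericalCubature

end

theorem theorem3p3 :
    -- (i), the bound
    (∀ n : ℕ, 1 ≤ n → ∃ C : ℝ, 0 < C ∧ ∀ t : ℕ, 1 ≤ t → ∀ θ : ℝ, 0 ≤ θ → θ < 1 →
      SphericalCubature.Theta t θ n ≤
        ENNReal.ofReal ((C * (t : ℝ) ^ (n - 1)) ^ (1 - θ))) ∧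
    -- (i), the asymptotic constant
    (∀ n : ℕ, 2 ≤ n → ∀ θ : ℝ, 0 ≤ θ → θ < 1 →
      limsup (fun t : ℕ => SphericalCubature.Theta t θ n /
          ENNReal.ofReal ((t : ℝ) ^ (((n : ℝ) - 1) * (1 - θ)))) atTop ≤
        ENNReal.ofReal (((2 : ℝ) ^ (n - 1) / ((n - 1)! : ℝ)) ^ (1 - θ))) ∧
    -- (ii), the bound
    (∀ t : ℕ, ∃ C : ℝ, 0 < C ∧ ∀ n : ℕ, 1 ≤ n → ∀ θ : ℝ, 0 ≤ θ → θ < 1 →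
      SphericalCubature.Theta t θ n ≤
        ENNReal.ofReal ((C * (n : ℝ) ^ (2 * (t / 2))) ^ (1 - θ))) ∧
    -- (ii), the explicit constants
    (∀ c : ℝ, 0 < c → ∀ t n : ℕ, 1 ≤ n → (t : ℝ) / c < (n : ℝ) → ∀ θ : ℝ, 0 ≤ θ → θ < 1 →
      (Even t → SphericalCubature.Theta t θ n ≤
        ENNReal.ofReal (((1 + 2 * c) ^ t / (t ! : ℝ) * (n : ℝ) ^ (2 * (t / 2))) ^ (1 - θ))) ∧
      (Odd t → SphericalCubature.Theta t θ n ≤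
        ENNReal.ofReal
          ((2 * ((1 + 2 * c) ^ (t - 1) / ((t - 1)! : ℝ)) * (n : ℝ) ^ (2 * (t / 2))) ^ (1 - θ)))) ∧
    -- (iii)
    (∀ t : ℕ, 2 ≤ t → ∃ C : ℝ, 0 < C ∧ ∀ n : ℕ, 1 ≤ n → ∀ θ : ℝ, 0 ≤ θ → θ < 1 →
      SphericalCubature.Theta t θ n ≤
        ENNReal.ofReal ((C * (n : ℝ) ^ (2 * (t / 2) - 1)) ^ (1 - θ))) := by
  exact ⟨fun _ hn => SphericalCubature.theta_le_fixed_dimension hn,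
    fun _ hn _ h0 h1 => SphericalCubature.limsup_theta_le hn h0 h1,
    SphericalCubature.theta_le_fixed_strength,
    fun _ hc _ _ hn htn _ h0 h1 => SphericalCubature.theta_le_explicit hc hn htn h0 h1,
    fun _ ht => SphericalCubature.theta_le_fixed_strength_array ht⟩
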